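/- **Setting.** Let $(M,E,g_M)$ be a quaternionic Kähler manifold: $E\subset\mathrm{End}(TM)$ is a rank-3 subbundle which near every point has a local basis of sections $J_1,J_2,J_3$ with $J_\alpha^2=-\mathrm{id}$, $J_\alpha J_{\alpha+1}=-J_{\alpha+1}J_\alpha=J_{\alpha+2}$, $g_M(J_\alpha\cdot,J_\alpha\cdot)=g_M$ (a quaternionic Hermitian basis), and local 1-forms $\omega_1,\omega_2,\omega_3$ with $\nabla_XJ_\alpha=\omega_{\alpha+2}(X)J_{\alpha+1}-\omega_{\alpha+1}(X)J_{\alpha+2}$ (indices mod 3), $\nabla$ being the Levi-Civita connection. Let $(N,g_N)$ be a Riemannian manifold with $\dim N<\dim M$, and $F:M\to N$ a surjective smooth submersion which is horizontally conformal with dilation $\lambda>0$: $g_N(F_*X,F_*Y)=\lambda^2g_M(X,Y)$ for $X,Y\in(\ker F_*)^\perp$. Assume that $F$ is an h-conformal semi-invariant submersion: every point of $M$ has a neighbourhood carrying a quaternionic Hermitian basis $\{J_1,J_2,J_3\}$ and a distribution $D_1\subset\ker F_*$ such that, with $D_2$ the orthogonal complement of $D_1$ in $\ker F_*$, one has $J_\alpha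 D_1=D_1$ and $J_\alpha D_2\subset(\ker F_*)^\perp$ for $\alpha=1,2,3$; such a basis is called an h-conformal semi-invariant basis. Let $\{J_1,J_2,J_3\}$ be an h-conformal semi-invariant basis on an open set $O\subset M$ (for instance $O=M$), with distribution $D_1$ and 1-forms $\omega_\alpha$ on $O$ as above. For $R\in\{J_1,J_2,J_3\}$ let $\mu^R$ be the orthogonal complement of $RD_2$ in $(\ker F_*)^\perp$. For $X\in\ker F_*$ write $RX=\phi_RX+\omega_RX$, and for $Z\in(\ker F_*)^\perp$ write $RZ=B_RZ+C_RZ$, where $\phi_RX$, $B_RZ$ are vertical (in $\ker F_*$; in fact in $D_1$ and $D_2$ respectively) and $\omega_RX$, $C_RZ$ are horizontal (in fact in $RD_2$ and $\mu^R$ respectively). Let $(\nabla F_*)(X,Y)=\nabla^F_XF_*Y-F_*(\nabla_XY)$ be the second fundamental form of $F$, where $\nabla^F$ is the pullback of the Levi-Civita connection of $N$, and $\mathcal T_XY=\mathcal H\nabla_{\mathcal VX}\mathcal VY+\mathcal V\nabla_{\mathcal VX}\mathcal HY$ O'Neill's tensor, with $\mathcal V$, $\mathcal H$ the orthogonal projections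 onto $\ker F_*$ and $(\ker F_*)^\perp$. **Theorem.** The following conditions (on $O$) are equivalent: (a) The distribution $D_1$ defines a totally geodesic foliation, i.e. $[U,V]\in\Gamma(D_1)$ and $\nabla_UV\in\Gamma(D_1)$ for all $U,V\in\Gamma(D_1)$. (b) For all $U,V\in\Gamma(D_1)$ and $X\in\Gamma((\ker F_*)^\perp)$: $(\nabla F_*)(V,J_1U)\in\Gamma(F_*\mu^{J_1})$ and $$\begin{aligned}g_N((\nabla F_*)(V,J_1U),F_*C_{J_1}X)={}&\lambda^2g_M(U,\mathcal T_V\omega_{J_1}B_{J_1}X)\\&-\lambda^2\big(g_M(\omega_3(V)\phi_{J_2}U,J_1X)-g_M(\omega_3(V)\omega_{J_2}U,J_1X)\big)\\&+\lambda^2\big(g_M(\omega_2(V)\phi_{J_3}U,J_1X)+g_M(\omega_2(V)\omega_{J_3}U,J_1X)\big).\end{aligned}$$ (c) For all $U,V\in\Gamma(D_1)$ and $X\in\Gamma((\ker F_*)^\perp)$: $(\nabla F_*)(V,J_2U)\in\Gamma(F_*\mu^{J_2})$ and $$\begin{aligned}g_N((\nabla F_*)(V,J_2U),F_*C_{J_2}X)={}&\lambda^2g_M(U,\mathcal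 T_V\omega_{J_2}B_{J_2}X)\\&-\lambda^2\big(g_M(\omega_3(V)\phi_{J_3}U,J_2X)-g_M(\omega_3(V)\omega_{J_3}U,J_2X)\big)\\&+\lambda^2\big(g_M(\omega_2(V)\phi_{J_1}U,J_2X)+g_M(\omega_2(V)\omega_{J_1}U,J_2X)\big).\end{aligned}$$ (d) For all $U,V\in\Gamma(D_1)$ and $X\in\Gamma((\ker F_*)^\perp)$: $(\nabla F_*)(V,J_3U)\in\Gamma(F_*\mu^{J_3})$ and $$\begin{aligned}g_N((\nabla F_*)(V,J_3U),F_*C_{J_3}X)={}&\lambda^2g_M(U,\mathcal T_V\omega_{J_3}B_{J_3}X)\\&-\lambda^2\big(g_M(\omega_3(V)\phi_{J_1}U,J_3X)-g_M(\omega_3(V)\omega_{J_1}U,J_3X)\big)\\&+\lambda^2\big(g_M(\omega_2(V)\phi_{J_2}U,J_3X)+g_M(\omega_2(V)\omega_{J_2}U,J_3X)\big).\end{aligned}$$ -/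

import Mathlib

open Bundle Set Filter Topology Manifold
open scoped ContDiff

noncomputable section

namespace HConformal

section LeviCivita

lemma finiteDimensional_tangent {E : Type*} [NormedAddCommGroup E] [NormedSpace ℝ E]
    [FiniteDimensional ℝ E] {M : Type*} [TopologicalSpace M] [ChartedSpace E M] (x : M) :
    FiniteDimensional ℝ (TangentSpace 𝓘(ℝ, E) x) :=
  inferInstanceAs (FiniteDimensional ℝ E)

attribute [local instance] finiteDimensional_tangent

variable {E : Type*} [NormedAddCommGroup E] [NormedSpace ℝ E]
  {M : Type*} [TopologicalSpace M] [ChartedSpace E M]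
  [RiemannianBundle (fun x : M ↦ TangentSpace 𝓘(ℝ, E) x)]

/-- The differential at `x` of the function `g(X, Y)`. -/
def dInner (X Y : Π x : M, TangentSpace 𝓘(ℝ, E) x) (x : M) : TangentSpace 𝓘(ℝ, E) x →L[ℝ] ℝ :=
  mvfderiv 𝓘(ℝ, E) (fun q ↦ (inner ℝ (X q) (Y q) : ℝ)) x

/-- The right hand side of the Koszul formula, so that
`koszul Y X Z x = 2 g(∇_X Y, Z)` at the point `x`. -/
def koszul (Y X Z : Π x : M, TangentSpace 𝓘(ℝ, E) x) (x : M) : ℝ :=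
  dInner Y Z x (X x) + dInner X Z x (Y x) - dInner X Y x (Z x)
    + inner ℝ (VectorField.mlieBracket 𝓘(ℝ, E) X Y x) (Z x)
    - inner ℝ (VectorField.mlieBracket 𝓘(ℝ, E) Y Z x) (X x)
    - inner ℝ (VectorField.mlieBracket 𝓘(ℝ, E) X Z x) (Y x)

lemma dInner_comm (X Y : Π x : M, TangentSpace 𝓘(ℝ, E) x) (x : M) :
    dInner X Y x = dInner Y X x := by
  simp only [dInner, real_inner_comm]

variable [IsManifold 𝓘(ℝ, E) ∞ M]

lemma eq_of_inner_field_eq {x : M} {v w : TangentSpace 𝓘(ℝ, E) x}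
    (h : ∀ Z : Π x : M, TangentSpace 𝓘(ℝ, E) x, MDiffAt (T% Z) x →
      inner ℝ v (Z x) = (inner ℝ w (Z x) : ℝ)) : v = w := by
  refine ext_inner_right ℝ fun z ↦ ?_
  simpa using h (FiberBundle.extend E z) (FiberBundle.mdifferentiableAt_extend ..)

variable [IsContMDiffRiemannianBundle 𝓘(ℝ, E) ∞ E (fun x : M ↦ TangentSpace 𝓘(ℝ, E) x)]

lemma mdiffAt_inner {x : M} {Y Z : Π x : M, TangentSpace 𝓘(ℝ, E) x}
    (hY : MDiffAt (T% Y) x) (hZ : MDiffAt (T% Z) x) :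
    MDiffAt (fun q ↦ (inner ℝ (Y q) (Z q) : ℝ)) x :=
  MDifferentiableAt.inner_bundle (E := fun x : M ↦ TangentSpace 𝓘(ℝ, E) x)
    (IB := 𝓘(ℝ, E)) (F := E) (b := id) hY hZ

lemma dInner_add_left {x : M} {X X' Y : Π x : M, TangentSpace 𝓘(ℝ, E) x}
    (hX : MDiffAt (T% X) x) (hX' : MDiffAt (T% X') x) (hY : MDiffAt (T% Y) x) :
    dInner (X + X') Y x = dInner X Y x + dInner X' Y x := by
  simp only [dInner, Pi.add_apply, inner_add_left]
  rw [mvfderiv_fun_add (mdiffAt_inner hX hY) (mdiffAt_inner hX' hY)]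

lemma dInner_smul_left {x : M} {f : M → ℝ} {X Y : Π x : M, TangentSpace 𝓘(ℝ, E) x}
    (hf : MDiffAt f x) (hX : MDiffAt (T% X) x) (hY : MDiffAt (T% Y) x)
    (v : TangentSpace 𝓘(ℝ, E) x) :
    dInner (f • X) Y x v =
      f x * dInner X Y x v + mvfderiv 𝓘(ℝ, E) f x v * inner ℝ (X x) (Y x) := by
  simp only [dInner, Pi.smul_apply', real_inner_smul_left]
  rw [mvfderiv_fun_mul hf (mdiffAt_inner hX hY)]
  simp
  ring

lemma dInner_add_right {x : M} {X Y Y' : Π x : M, TangentSpace 𝓘(ℝ, E) x}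
    (hX : MDiffAt (T% X) x) (hY : MDiffAt (T% Y) x) (hY' : MDiffAt (T% Y') x) :
    dInner X (Y + Y') x = dInner X Y x + dInner X Y' x := by
  rw [dInner_comm, dInner_add_left hY hY' hX, dInner_comm Y, dInner_comm Y']

lemma dInner_smul_right {x : M} {f : M → ℝ} {X Y : Π x : M, TangentSpace 𝓘(ℝ, E) x}
    (hf : MDiffAt f x) (hX : MDiffAt (T% X) x) (hY : MDiffAt (T% Y) x)
    (v : TangentSpace 𝓘(ℝ, E) x) :
    dInner X (f • Y) x v =
      f x * dInner X Y x v + mvfderiv 𝓘(ℝ, E) f x v * inner ℝ (X x) (Y x) := by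
  rw [dInner_comm, dInner_smul_left hf hY hX, dInner_comm Y, real_inner_comm]


variable [FiniteDimensional ℝ E]

lemma koszul_tensorial_left {x : M} {Y Z : Π x : M, TangentSpace 𝓘(ℝ, E) x}
    (hY : MDiffAt (T% Y) x) (hZ : MDiffAt (T% Z) x) :
    TensorialAt 𝓘(ℝ, E) E (fun X ↦ koszul Y X Z x) x where
  smul {f X} hf hX := by
    simp only [koszul, dInner_smul_left hf hX hZ, dInner_smul_left hf hX hY,
      VectorField.mlieBracket_smul_left hf hX, Pi.smul_apply', inner_add_left,
      real_inner_smul_left, real_inner_smul_right, map_smul, smul_eq_mul]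
    ring
  add {X X'} hX hX' := by
    simp only [koszul, dInner_add_left hX hX' hZ, dInner_add_left hX hX' hY,
      VectorField.mlieBracket_add_left hX hX', Pi.add_apply, inner_add_left, inner_add_right,
      map_add, add_apply]
    ring

lemma koszul_tensorial_right {x : M} {Y X : Π x : M, TangentSpace 𝓘(ℝ, E) x}
    (hY : MDiffAt (T% Y) x) (hX : MDiffAt (T% X) x) :
    TensorialAt 𝓘(ℝ, E) E (fun Z ↦ koszul Y X Z x) x where
  smul {f Z} hf hZ := by
    simp only [koszul, dInner_smul_right hf hX hZ, dInner_smul_right hf hY hZ,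
      VectorField.mlieBracket_smul_right hf hZ, Pi.smul_apply', inner_add_left,
      real_inner_smul_left, real_inner_smul_right, map_smul, smul_eq_mul]
    rw [real_inner_comm (Z x) (X x), real_inner_comm (Z x) (Y x)]
    ring
  add {Z Z'} hZ hZ' := by
    simp only [koszul, dInner_add_right hX hZ hZ', dInner_add_right hY hZ hZ',
      VectorField.mlieBracket_add_right hZ hZ', Pi.add_apply, inner_add_left, inner_add_right,
      map_add, add_apply]
    ring

/-- For `Y` differentiable at `x`, the bilinear form `(X, Z) ↦ 2 g(∇_X Y, Z)` on `T_x M`. -/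
def koszulForm {x : M} {Y : Π x : M, TangentSpace 𝓘(ℝ, E) x} (hY : MDiffAt (T% Y) x) :
    TangentSpace 𝓘(ℝ, E) x →L[ℝ] TangentSpace 𝓘(ℝ, E) x →L[ℝ] ℝ :=
  TensorialAt.mkHom₂ (fun X Z ↦ koszul Y X Z x) x
    (fun _ hZ ↦ koszul_tensorial_left hY hZ) (fun _ hX ↦ koszul_tensorial_right hY hX)

lemma koszulForm_apply {x : M} {X Y Z : Π x : M, TangentSpace 𝓘(ℝ, E) x}
    (hX : MDiffAt (T% X) x) (hY : MDiffAt (T% Y) x) (hZ : MDiffAt (T% Z) x) :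
    koszulForm hY (X x) (Z x) = koszul Y X Z x :=
  TensorialAt.mkHom₂_apply _ _ hX hZ

open scoped Classical in
/-- The Levi-Civita connection as a function: `leviCivitaFun Y x v` is the vector `(∇_v Y)(x)`
with `2 g(∇_v Y, z)` given by the Koszul formula for all `z`, expanded in an orthonormal basis of
`T_x M` (with value `0` where `Y` is not differentiable). -/
def leviCivitaFun (Y : Π x : M, TangentSpace 𝓘(ℝ, E) x) (x : M) :
    TangentSpace 𝓘(ℝ, E) x →L[ℝ] TangentSpace 𝓘(ℝ, E) x :=
  if hY : MDiffAt (T% Y) x then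
    ∑ i, (1 / 2 : ℝ) • ((koszulForm hY).flip
      (stdOrthonormalBasis ℝ (TangentSpace 𝓘(ℝ, E) x) i)).smulRight
        (stdOrthonormalBasis ℝ (TangentSpace 𝓘(ℝ, E) x) i)
  else 0

lemma inner_leviCivitaFun {x : M} {X Y Z : Π x : M, TangentSpace 𝓘(ℝ, E) x}
    (hX : MDiffAt (T% X) x) (hY : MDiffAt (T% Y) x) (hZ : MDiffAt (T% Z) x) :
    inner ℝ (leviCivitaFun Y x (X x)) (Z x) = (1 / 2 : ℝ) * koszul Y X Z x := by
  rw [← koszulForm_apply hX hY hZ, leviCivitaFun, dif_pos hY]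
  set b := stdOrthonormalBasis ℝ (TangentSpace 𝓘(ℝ, E) x)
  conv_rhs => rw [← b.sum_repr' (Z x)]
  simp only [FunLike.coe_sum, Finset.sum_apply, sum_inner, map_sum, Finset.mul_sum]
  refine Finset.sum_congr rfl fun i _ ↦ ?_
  simp [real_inner_smul_left]
  ring

/-- The Levi-Civita connection of the Riemannian manifold `M`. -/
def leviCivita : CovariantDerivative 𝓘(ℝ, E) E (fun x : M ↦ TangentSpace 𝓘(ℝ, E) x) where
  toFun := leviCivitaFun
  isCovariantDerivativeOnUniv :=
    { add := by
        intro Y Y' x hY hY' _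
        ext v
        obtain ⟨X, hX, rfl⟩ : ∃ X : Π x : M, TangentSpace 𝓘(ℝ, E) x, MDiffAt (T% X) x ∧ X x = v :=
          ⟨FiberBundle.extend E v, FiberBundle.mdifferentiableAt_extend .., by simp⟩
        refine eq_of_inner_field_eq fun Z hZ ↦ ?_
        rw [add_apply, inner_add_left, inner_leviCivitaFun hX hY hZ,
          inner_leviCivitaFun hX hY' hZ,
          inner_leviCivitaFun hX (mdifferentiableAt_add_section hY hY') hZ]
        simp only [koszul, dInner_add_left hY hY' hZ, dInner_add_right hX hY hY',
          VectorField.mlieBracket_add_left hY hY', VectorField.mlieBracket_add_right hY hY',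
          Pi.add_apply, inner_add_left, inner_add_right, map_add, add_apply]
        ring
      leibniz := by
        intro Y f x hY hf _
        ext v
        obtain ⟨X, hX, rfl⟩ : ∃ X : Π x : M, TangentSpace 𝓘(ℝ, E) x, MDiffAt (T% X) x ∧ X x = v :=
          ⟨FiberBundle.extend E v, FiberBundle.mdifferentiableAt_extend .., by simp⟩
        refine eq_of_inner_field_eq fun Z hZ ↦ ?_
        rw [add_apply, inner_add_left, smul_apply, real_inner_smul_left,
          inner_leviCivitaFun hX hY hZ, inner_leviCivitaFun hX (hf.smul_section hY) hZ]
        simp only [koszul, dInner_smul_left hf hY hZ, dInner_smul_right hf hX hY,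
          VectorField.mlieBracket_smul_left hf hY, VectorField.mlieBracket_smul_right hf hY,
          Pi.smul_apply', inner_add_left, real_inner_smul_left, real_inner_smul_right, map_smul,
          smul_eq_mul, ContinuousLinearMap.smulRight_apply]
        rw [real_inner_comm (Y x) (X x)]
        ring }

lemma leviCivita_torsion {x : M} {X Y : Π x : M, TangentSpace 𝓘(ℝ, E) x}
    (hX : MDiffAt (T% X) x) (hY : MDiffAt (T% Y) x) :
    leviCivita Y x (X x) - leviCivita X x (Y x) = VectorField.mlieBracket 𝓘(ℝ, E) X Y x := by
  refine eq_of_inner_field_eq fun Z hZ ↦ ?_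
  change inner ℝ (leviCivitaFun Y x (X x) - leviCivitaFun X x (Y x)) (Z x) = _
  rw [inner_sub_left, inner_leviCivitaFun hX hY hZ, inner_leviCivitaFun hY hX hZ]
  simp only [koszul]
  rw [dInner_comm Y X, VectorField.mlieBracket_swap_apply (V := Y) (W := X), inner_neg_left]
  ring

lemma leviCivita_metric {x : M} {X Y Z : Π x : M, TangentSpace 𝓘(ℝ, E) x}
    (hX : MDiffAt (T% X) x) (hY : MDiffAt (T% Y) x) (hZ : MDiffAt (T% Z) x) :
    dInner Y Z x (X x) =
      inner ℝ (leviCivita Y x (X x)) (Z x) + inner ℝ (Y x) (leviCivita Z x (X x)) := by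
  change _ = inner ℝ (leviCivitaFun Y x (X x)) (Z x) + inner ℝ (Y x) (leviCivitaFun Z x (X x))
  rw [real_inner_comm (leviCivitaFun Z x (X x)), inner_leviCivitaFun hX hY hZ,
    inner_leviCivitaFun hX hZ hY]
  simp only [koszul]
  rw [dInner_comm Z Y, VectorField.mlieBracket_swap_apply (V := Z) (W := Y), inner_neg_left]
  ring

end LeviCivita
section Submersions

attribute [local instance] finiteDimensional_tangent

variable {E : Type*} [NormedAddCommGroup E] [NormedSpace ℝ E] [FiniteDimensional ℝ E]
  {M : Type*} [TopologicalSpace M] [ChartedSpace E M] [IsManifold 𝓘(ℝ, E) ∞ M]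
  [RiemannianBundle (fun x : M ↦ TangentSpace 𝓘(ℝ, E) x)]
  [IsContMDiffRiemannianBundle 𝓘(ℝ, E) ∞ E (fun x : M ↦ TangentSpace 𝓘(ℝ, E) x)]
  {E' : Type*} [NormedAddCommGroup E'] [NormedSpace ℝ E'] [FiniteDimensional ℝ E']
  {N : Type*} [TopologicalSpace N] [ChartedSpace E' N] [IsManifold 𝓘(ℝ, E') ∞ N]
  [RiemannianBundle (fun y : N ↦ TangentSpace 𝓘(ℝ, E') y)]
  [IsContMDiffRiemannianBundle 𝓘(ℝ, E') ∞ E' (fun y : N ↦ TangentSpace 𝓘(ℝ, E') y)]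

/-! ### Vector fields, distributions, foliations -/

/-- `X` is a smooth vector field on the open set `O`. -/
def IsSmoothFieldOn (O : Set M) (X : Π x : M, TangentSpace 𝓘(ℝ, E) x) : Prop :=
  CMDiff[O] ∞ (T% X)

/-- `X ∈ Γ(D)`: `X` is a smooth vector field on `O` with values in `D`. -/
def IsSectionOn (O : Set M) (D : Π x : M, Submodule ℝ (TangentSpace 𝓘(ℝ, E) x))
    (X : Π x : M, TangentSpace 𝓘(ℝ, E) x) : Prop :=
  IsSmoothFieldOn O X ∧ ∀ x ∈ O, X x ∈ D x

/-- `D` is a smooth distribution on `O`: locally it is spanned by a smooth frame. -/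
def IsDistributionOn (O : Set M) (D : Π x : M, Submodule ℝ (TangentSpace 𝓘(ℝ, E) x)) : Prop :=
  ∀ x ∈ O, ∃ W : Set M, IsOpen W ∧ x ∈ W ∧ W ⊆ O ∧
    ∃ (k : ℕ) (e : Fin k → Π x : M, TangentSpace 𝓘(ℝ, E) x),
      (∀ i, IsSmoothFieldOn W (e i)) ∧
      ∀ y ∈ W, LinearIndependent ℝ (fun i ↦ e i y) ∧
        Submodule.span ℝ (Set.range fun i ↦ e i y) = D y

/-- The distribution `D` defines a totally geodesic foliation on `O`: it is involutive, and its
leaves are totally geodesic, that is, `∇_X Y` is tangent to `D` whenever `X` and `Y` are. -/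
def DefinesTotallyGeodesicFoliation (O : Set M)
    (D : Π x : M, Submodule ℝ (TangentSpace 𝓘(ℝ, E) x)) : Prop :=
  ∀ X Y : Π x : M, TangentSpace 𝓘(ℝ, E) x, IsSectionOn O D X → IsSectionOn O D Y →
    ∀ x ∈ O, VectorField.mlieBracket 𝓘(ℝ, E) X Y x ∈ D x ∧ leviCivita Y x (X x) ∈ D x

/-! ### Quaternionic Kähler structures -/

/-- `(J 0, J 1, J 2)` is a quaternionic Hermitian basis on `O` of the bundle of endomorphisms `Q`
of the tangent spaces. -/
structure IsQuaternionicHermitianBasis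
    (Q : Π x : M, Submodule ℝ (TangentSpace 𝓘(ℝ, E) x →L[ℝ] TangentSpace 𝓘(ℝ, E) x))
    (O : Set M) (J : Fin 3 → Π x : M, TangentSpace 𝓘(ℝ, E) x →L[ℝ] TangentSpace 𝓘(ℝ, E) x) :
    Prop where
  smooth : ∀ α, ContMDiffOn 𝓘(ℝ, E) (𝓘(ℝ, E).prod 𝓘(ℝ, E →L[ℝ] E)) ∞
    (fun x ↦ TotalSpace.mk' (E →L[ℝ] E)
      (E := fun x : M ↦ TangentSpace 𝓘(ℝ, E) x →L[ℝ] TangentSpace 𝓘(ℝ, E) x) x (J α x)) O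
  linearIndependent : ∀ x ∈ O, LinearIndependent ℝ (fun α ↦ J α x)
  span_eq : ∀ x ∈ O, Submodule.span ℝ (Set.range fun α ↦ J α x) = Q x
  sq : ∀ α, ∀ x ∈ O, ∀ v, J α x (J α x v) = -v
  mul : ∀ α, ∀ x ∈ O, ∀ v, J α x (J (α + 1) x v) = J (α + 2) x v
  mul_swap : ∀ α, ∀ x ∈ O, ∀ v, J (α + 1) x (J α x v) = -J (α + 2) x v
  hermitian : ∀ α, ∀ x ∈ O, ∀ v w, (inner ℝ (J α x v) (J α x w) : ℝ) = inner ℝ v w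

/-- `θ 0, θ 1, θ 2` are smooth 1-forms on `O` with
`∇_X J_α = θ_{α+2}(X) J_{α+1} - θ_{α+1}(X) J_{α+2}` (indices modulo 3),
where `(∇_X J) Y = ∇_X (J Y) - J (∇_X Y)`. -/
structure IsConnectionForms (O : Set M)
    (J : Fin 3 → Π x : M, TangentSpace 𝓘(ℝ, E) x →L[ℝ] TangentSpace 𝓘(ℝ, E) x)
    (θ : Fin 3 → Π x : M, TangentSpace 𝓘(ℝ, E) x →L[ℝ] ℝ) : Prop where
  smooth : ∀ α, ContMDiffOn 𝓘(ℝ, E) (𝓘(ℝ, E).prod 𝓘(ℝ, E →L[ℝ] ℝ)) ∞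
    (fun x ↦ TotalSpace.mk' (E →L[ℝ] ℝ)
      (E := fun x : M ↦ TangentSpace 𝓘(ℝ, E) x →L[ℝ] ℝ) x (θ α x)) O
  deriv : ∀ α, ∀ X Y : Π x : M, TangentSpace 𝓘(ℝ, E) x,
    IsSmoothFieldOn O X → IsSmoothFieldOn O Y → ∀ x ∈ O,
      leviCivita (fun q ↦ J α q (Y q)) x (X x) - J α x (leviCivita Y x (X x)) =
        θ (α + 2) x (X x) • J (α + 1) x (Y x) - θ (α + 1) x (X x) • J (α + 2) x (Y x)

/-- `(M, Q, g)` is a quaternionic Kähler manifold. -/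
def IsQuaternionicKaehler
    (Q : Π x : M, Submodule ℝ (TangentSpace 𝓘(ℝ, E) x →L[ℝ] TangentSpace 𝓘(ℝ, E) x)) : Prop :=
  ∀ p : M, ∃ O : Set M, IsOpen O ∧ p ∈ O ∧ ∃ J θ,
    IsQuaternionicHermitianBasis Q O J ∧ IsConnectionForms O J θ

/-! ### Maps between Riemannian manifolds -/

/-- The vertical space `ker F_*` at `x`. -/
def vertical (F : M → N) (x : M) : Submodule ℝ (TangentSpace 𝓘(ℝ, E) x) :=
  (mfderiv 𝓘(ℝ, E) 𝓘(ℝ, E') F x).ker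

/-- The horizontal space `(ker F_*)ᗮ` at `x`. -/
def horizontal (F : M → N) (x : M) : Submodule ℝ (TangentSpace 𝓘(ℝ, E) x) :=
  (vertical (E := E) (E' := E') F x)ᗮ

/-- The orthogonal projection of `T_x M` onto the vertical space. -/
def verPart (F : M → N) (x : M) : TangentSpace 𝓘(ℝ, E) x →L[ℝ] TangentSpace 𝓘(ℝ, E) x :=
  (vertical (E := E) (E' := E') F x).starProjection

/-- The orthogonal projection of `T_x M` onto the horizontal space. -/
def horPart (F : M → N) (x : M) : TangentSpace 𝓘(ℝ, E) x →L[ℝ] TangentSpace 𝓘(ℝ, E) x :=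
  (horizontal (E := E) (E' := E') F x).starProjection

/-- `F : M → N` is a horizontally conformal submersion onto `N` with dilation `lam`. -/
structure IsHConformalSubmersion (F : M → N) (lam : M → ℝ) : Prop where
  dim_lt : Module.finrank ℝ E' < Module.finrank ℝ E
  smooth : ContMDiff 𝓘(ℝ, E) 𝓘(ℝ, E') ∞ F
  surjective : Function.Surjective F
  submersion : ∀ x, Function.Surjective (mfderiv 𝓘(ℝ, E) 𝓘(ℝ, E') F x)
  dilation_pos : ∀ x, 0 < lam x
  conformal : ∀ x, ∀ v ∈ horizontal (E := E) (E' := E') F x,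
    ∀ w ∈ horizontal (E := E) (E' := E') F x,
    (inner ℝ (mfderiv 𝓘(ℝ, E) 𝓘(ℝ, E') F x v) (mfderiv 𝓘(ℝ, E) 𝓘(ℝ, E') F x w) : ℝ) =
      lam x ^ 2 * inner ℝ v w

/-- The connection `∇^F` on the pullback bundle `F⁻¹TN` induced by the Levi-Civita connection of
`N`: writing a section `s` along `F` near `x` as `s = ∑ sᵢ • (eᵢ ∘ F)` for a local frame `eᵢ` of
`TN` around `F x`, one has `∇^F_v s = ∑ v(sᵢ) • eᵢ + sᵢ • ∇_{F_* v} eᵢ`. -/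
def covAlong (F : M → N) (s : Π x : M, TangentSpace 𝓘(ℝ, E') (F x)) (x : M)
    (v : TangentSpace 𝓘(ℝ, E) x) : TangentSpace 𝓘(ℝ, E') (F x) :=
  let e := trivializationAt E' (fun y : N ↦ TangentSpace 𝓘(ℝ, E') y) (F x)
  let b := Module.finBasis ℝ E'
  ∑ i, (mvfderiv 𝓘(ℝ, E) (fun q ↦ e.localFrameCoeff 𝓘(ℝ, E') b i (F q) (s q)) x v •
      e.localFrame b i (F x) +
    e.localFrameCoeff 𝓘(ℝ, E') b i (F x) (s x) •
      leviCivita (e.localFrame b i) (F x) (mfderiv 𝓘(ℝ, E) 𝓘(ℝ, E') F x v))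

/-- The second fundamental form `(∇F_*)(X, Y) = ∇^F_X (F_* Y) - F_* (∇_X Y)` of `F`. -/
def secondFundamentalForm (F : M → N) (X Y : Π x : M, TangentSpace 𝓘(ℝ, E) x) (x : M) :
    TangentSpace 𝓘(ℝ, E') (F x) :=
  covAlong F (fun q ↦ mfderiv 𝓘(ℝ, E) 𝓘(ℝ, E') F q (Y q)) x (X x) -
    mfderiv 𝓘(ℝ, E) 𝓘(ℝ, E') F x (leviCivita Y x (X x))

/-- O'Neill's tensor `𝒯_X Y = ℋ ∇_{𝒱X} 𝒱Y + 𝒱 ∇_{𝒱X} ℋY`. -/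
def oneillT (F : M → N) (X Y : Π x : M, TangentSpace 𝓘(ℝ, E) x) (x : M) :
    TangentSpace 𝓘(ℝ, E) x :=
  horPart (E' := E') F x
      (leviCivita (fun q ↦ verPart (E' := E') F q (Y q)) x (verPart (E' := E') F x (X x))) +
    verPart (E' := E') F x
      (leviCivita (fun q ↦ horPart (E' := E') F q (Y q)) x (verPart (E' := E') F x (X x)))

/-! ### Semi-invariant submersions -/

/-- The orthogonal complement `D₂` of `D₁` in `ker F_*`. -/
def distTwo (F : M → N) (D₁ : Π x : M, Submodule ℝ (TangentSpace 𝓘(ℝ, E) x)) (x : M) :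
    Submodule ℝ (TangentSpace 𝓘(ℝ, E) x) :=
  (D₁ x)ᗮ ⊓ vertical (E' := E') F x

/-- The orthogonal complement `μ^R` of `R D₂` in `(ker F_*)ᗮ`. -/
def distMu (F : M → N) (D₁ : Π x : M, Submodule ℝ (TangentSpace 𝓘(ℝ, E) x))
    (R : Π x : M, TangentSpace 𝓘(ℝ, E) x →L[ℝ] TangentSpace 𝓘(ℝ, E) x) (x : M) :
    Submodule ℝ (TangentSpace 𝓘(ℝ, E) x) :=
  ((distTwo (E' := E') F D₁ x).map (R x).toLinearMap)ᗮ ⊓ horizontal (E' := E') F x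

/-- `(J 0, J 1, J 2)` is an h-conformal semi-invariant basis on `O` for `F`, with associated
distribution `D₁`. -/
structure IsSemiInvariantBasis
    (Q : Π x : M, Submodule ℝ (TangentSpace 𝓘(ℝ, E) x →L[ℝ] TangentSpace 𝓘(ℝ, E) x))
    (F : M → N) (O : Set M)
    (J : Fin 3 → Π x : M, TangentSpace 𝓘(ℝ, E) x →L[ℝ] TangentSpace 𝓘(ℝ, E) x)
    (D₁ : Π x : M, Submodule ℝ (TangentSpace 𝓘(ℝ, E) x)) : Prop where
  basis : IsQuaternionicHermitianBasis Q O J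
  distribution : IsDistributionOn O D₁
  le_vertical : ∀ x ∈ O, D₁ x ≤ vertical (E' := E') F x
  map_one : ∀ α, ∀ x ∈ O, (D₁ x).map (J α x).toLinearMap = D₁ x
  map_two : ∀ α, ∀ x ∈ O,
    (distTwo (E' := E') F D₁ x).map (J α x).toLinearMap ≤ horizontal (E' := E') F x

/-- `F : (M, Q, g) → N` is an h-conformal semi-invariant submersion with dilation `lam`. -/
structure IsHConformalSemiInvariantSubmersion
    (Q : Π x : M, Submodule ℝ (TangentSpace 𝓘(ℝ, E) x →L[ℝ] TangentSpace 𝓘(ℝ, E) x))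
    (F : M → N) (lam : M → ℝ) : Prop where
  submersion : IsHConformalSubmersion (E := E) (E' := E') F lam
  exists_basis : ∀ p : M, ∃ O : Set M, IsOpen O ∧ p ∈ O ∧ ∃ J D₁,
    IsSemiInvariantBasis (E' := E') Q F O J D₁

/-- For vertical `X`, the component `φ_R X` of `R X = φ_R X + ω_R X` in `ker F_*`. It lies in `D₁`,
since `R D₁ = D₁` and `R D₂` is horizontal. -/
def phiPart (F : M → N) (R : Π x : M, TangentSpace 𝓘(ℝ, E) x →L[ℝ] TangentSpace 𝓘(ℝ, E) x)
    (X : Π x : M, TangentSpace 𝓘(ℝ, E) x) (x : M) : TangentSpace 𝓘(ℝ, E) x :=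
  verPart (E' := E') F x (R x (X x))

/-- For vertical `X`, the component `ω_R X` of `R X = φ_R X + ω_R X` in `(ker F_*)ᗮ`. It lies in
`R D₂`, since `R D₁ = D₁` and `R D₂` is horizontal. -/
def omegaPart (F : M → N) (R : Π x : M, TangentSpace 𝓘(ℝ, E) x →L[ℝ] TangentSpace 𝓘(ℝ, E) x)
    (X : Π x : M, TangentSpace 𝓘(ℝ, E) x) (x : M) : TangentSpace 𝓘(ℝ, E) x :=
  horPart (E' := E') F x (R x (X x))

/-- For horizontal `Z`, the component `B_R Z` of `R Z = B_R Z + C_R Z` in `ker F_*`. It lies in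
`D₂`, since `g(R Z, Y) = -g(Z, R Y) = 0` for `Y ∈ D₁`. -/
def bPart (F : M → N) (R : Π x : M, TangentSpace 𝓘(ℝ, E) x →L[ℝ] TangentSpace 𝓘(ℝ, E) x)
    (Z : Π x : M, TangentSpace 𝓘(ℝ, E) x) (x : M) : TangentSpace 𝓘(ℝ, E) x :=
  verPart (E' := E') F x (R x (Z x))

/-- For horizontal `Z`, the component `C_R Z` of `R Z = B_R Z + C_R Z` in `(ker F_*)ᗮ`. It lies in
`μ^R`, since `g(R Z, R W) = g(Z, W) = 0` for `W ∈ D₂`. -/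
def cPart (F : M → N) (R : Π x : M, TangentSpace 𝓘(ℝ, E) x →L[ℝ] TangentSpace 𝓘(ℝ, E) x)
    (Z : Π x : M, TangentSpace 𝓘(ℝ, E) x) (x : M) : TangentSpace 𝓘(ℝ, E) x :=
  horPart (E' := E') F x (R x (Z x))

/-- The pair of conditions attached to `R = J α`: for all `U, V ∈ Γ(D₁)`,
`(∇F_*)(V, R U) ∈ Γ(F_* μ^R)`, and for all `X ∈ Γ((ker F_*)ᗮ)` the value of
`g_N((∇F_*)(V, R U), F_* C_R X)` is the stated one. The 1-forms `ω₁, ω₂, ω₃` of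
the quaternionic Kähler structure are `θ 0, θ 1, θ 2`. -/
def SecondFundamentalFormCondition (F : M → N) (lam : M → ℝ) (O : Set M)
    (J : Fin 3 → Π x : M, TangentSpace 𝓘(ℝ, E) x →L[ℝ] TangentSpace 𝓘(ℝ, E) x)
    (D₁ : Π x : M, Submodule ℝ (TangentSpace 𝓘(ℝ, E) x))
    (θ : Fin 3 → Π x : M, TangentSpace 𝓘(ℝ, E) x →L[ℝ] ℝ) (α : Fin 3) : Prop :=
  ∀ U V : Π x : M, TangentSpace 𝓘(ℝ, E) x, IsSectionOn O D₁ U → IsSectionOn O D₁ V →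
    (∀ x ∈ O, secondFundamentalForm F V (fun q ↦ J α q (U q)) x ∈
      (distMu (E' := E') F D₁ (J α) x).map (mfderiv 𝓘(ℝ, E) 𝓘(ℝ, E') F x).toLinearMap) ∧
    ∀ X : Π x : M, TangentSpace 𝓘(ℝ, E) x, IsSectionOn O (horizontal (E' := E') F) X →
      ∀ x ∈ O,
        (inner ℝ (secondFundamentalForm F V (fun q ↦ J α q (U q)) x)
          (mfderiv 𝓘(ℝ, E) 𝓘(ℝ, E') F x (cPart (E' := E') F (J α) X x)) : ℝ) =
        lam x ^ 2 * inner ℝ (U x) (oneillT (E' := E') F V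
            (omegaPart (E' := E') F (J α) (bPart (E' := E') F (J α) X)) x)
        - lam x ^ 2 *
          (inner ℝ (θ 2 x (V x) • phiPart (E' := E') F (J (α + 1)) U x) (J α x (X x))
            - inner ℝ (θ 2 x (V x) • omegaPart (E' := E') F (J (α + 1)) U x) (J α x (X x)))
        + lam x ^ 2 *
          (inner ℝ (θ 1 x (V x) • phiPart (E' := E') F (J (α + 2)) U x) (J α x (X x))
            + inner ℝ (θ 1 x (V x) • omegaPart (E' := E') F (J (α + 2)) U x) (J α x (X x)))

end Submersions

end HConformal

end

/-! Fix `R = J α` and write `w = ∇_V U` for `U, V ∈ Γ(D₁)`. Since `R U` is vertical, its image under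
`F_*` is identically zero, so `(∇F_*)(V, R U) = -F_*(∇_V (R U)) = -F_*(R w)`: the connection-form
terms of `∇R` lie in `D₁` and are killed by `F_*` (`secondFundamentalForm_eq`).

The tangent space splits orthogonally as `D₁ ⊕ D₂ ⊕ horizontal`, and the two halves of the condition
test `w` against the last two summands. Membership in `F_* μ^R` says that `R w ⊥ R D₂`, that is `w ⊥
D₂` (`neg_mfderiv_mem_map_distMu_iff`). In the displayed equation every `θ` term vanishes, whatever
its sign or index. Conformality turns the left side into `λ² g(w, R C X)`, while `ω B X = -X - R C
X` makes the `𝒯` term `λ² (g(w, X) + g(w, R C X))`; what remains is `g(w, X) = 0`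
(`inner_secondFundamentalForm_eq_iff`). Together they say `w ∈ D₁`, and involutivity follows since
the connection is torsion-free.

The analytic input is that horizontal projection preserves smoothness (`contMDiffAt_horPart`): it
makes `ω B X` differentiable and extends a horizontal vector to a smooth horizontal field. -/

noncomputable section

namespace HConformal

/-! ### Orthogonal projection away from a kernel, as the solution of a linear system. -/

section LinearAlgebra

variable {V : Type*} [NormedAddCommGroup V] [InnerProductSpace ℝ V]
  {ι κ : Type*} [Fintype ι] [Fintype κ]

/-- The matrix of the linear system `⟪h, eᵢ⟫ = ∑ ηₐ (A eᵢ)ₐ`, `A h = y` in the unknowns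
`h = ∑ cⱼ eⱼ` and `η`, whose solution `h` is the vector of minimal norm with `A h = y`. -/
def saddleMatrix (e : ι → V) (A : V →ₗ[ℝ] κ → ℝ) : Matrix (ι ⊕ κ) (ι ⊕ κ) ℝ :=
  Matrix.fromBlocks (.of fun i j ↦ inner ℝ (e i) (e j)) (.of fun i a ↦ -A (e i) a)
    (.of fun a j ↦ A (e j) a) 0

lemma saddleMatrix_mulVec_inl (e : ι → V) (A : V →ₗ[ℝ] κ → ℝ) (z : ι ⊕ κ → ℝ) (i : ι) :
    (saddleMatrix e A).mulVec z (.inl i) =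
      inner ℝ (e i) (∑ j, z (.inl j) • e j) - ∑ a, z (.inr a) * A (e i) a := by
  simp [saddleMatrix, Matrix.mulVec, dotProduct, inner_sum, real_inner_smul_right, mul_comm,
    sub_eq_add_neg]

lemma saddleMatrix_mulVec_inr (e : ι → V) (A : V →ₗ[ℝ] κ → ℝ) (z : ι ⊕ κ → ℝ) (a : κ) :
    (saddleMatrix e A).mulVec z (.inr a) = A (∑ j, z (.inl j) • e j) a := by
  simp [saddleMatrix, Matrix.mulVec, dotProduct, mul_comm]

/-- Both sides are linear in `v`, and the upper block of the system is their equality on the basis.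
It follows that the solution vector is orthogonal to `ker A`. -/
lemma inner_eq_of_saddleMatrix_mulVec_inl (e : Module.Basis ι ℝ V) (A : V →ₗ[ℝ] κ → ℝ)
    {z : ι ⊕ κ → ℝ} (hz : ∀ i, (saddleMatrix e A).mulVec z (.inl i) = 0) (v : V) :
    inner ℝ v (∑ j, z (.inl j) • e j) = ∑ a, z (.inr a) * A v a := by
  have h : (innerₗ V).flip (∑ j, z (.inl j) • e j) =
      ∑ a, z (.inr a) • (LinearMap.proj a ∘ₗ A) := by
    refine e.ext fun i ↦ ?_
    have := hz i
    rw [saddleMatrix_mulVec_inl, sub_eq_zero] at this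
    simpa only [LinearMap.flip_apply, innerₗ_apply_apply, LinearMap.sum_apply, LinearMap.smul_apply,
      LinearMap.comp_apply, LinearMap.proj_apply, smul_eq_mul] using this
  simpa only [LinearMap.flip_apply, innerₗ_apply_apply, LinearMap.sum_apply, LinearMap.smul_apply,
    LinearMap.comp_apply, LinearMap.proj_apply, smul_eq_mul] using congr($h v)

variable [DecidableEq ι] [DecidableEq κ]

/-- A null vector gives `h` both in `ker A` and orthogonal to it, so `h = 0`. The multipliers then
pair to zero with the whole range of `A`, which is everything. -/
lemma det_saddleMatrix_ne_zero (e : Module.Basis ι ℝ V) {A : V →ₗ[ℝ] κ → ℝ}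
    (hA : Function.Surjective A) : (saddleMatrix e A).det ≠ 0 := by
  rw [Ne, ← Matrix.exists_mulVec_eq_zero_iff]
  rintro ⟨z, hz0, hz⟩
  have hv := inner_eq_of_saddleMatrix_mulVec_inl e A (z := z) fun i ↦ congr_fun hz _
  have hAh : A (∑ j, z (.inl j) • e j) = 0 := by
    ext a
    rw [← saddleMatrix_mulVec_inr, hz]
    rfl
  have hh : ∑ j, z (.inl j) • e j = 0 := by
    rw [← inner_self_eq_zero (𝕜 := ℝ), hv, hAh]
    simp
  refine hz0 (funext fun s ↦ ?_)
  rcases s with i | a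
  · exact Fintype.linearIndependent_iff.1 e.linearIndependent _ hh i
  · obtain ⟨v, hv'⟩ := hA (Pi.single a 1)
    have := hv v
    rw [hh, hv'] at this
    simpa [Pi.single_apply] using this.symm

/-- The solution `h` satisfies `h ⊥ ker A` and `y - h ∈ ker A`, which characterises the projection.
The formula is rational in the Gram matrix and in `A`, so it depends smoothly on them. -/
lemma starProjection_ker_orthogonal_eq_sum [FiniteDimensional ℝ V] (e : Module.Basis ι ℝ V)
    {A : V →ₗ[ℝ] κ → ℝ} (hA : Function.Surjective A) (y : V) :
    A.kerᗮ.starProjection y =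
      ∑ j, (saddleMatrix e A)⁻¹.mulVec (Sum.elim 0 (A y)) (.inl j) • e j := by
  set z := (saddleMatrix e A)⁻¹.mulVec (Sum.elim 0 (A y)) with hz
  have hMz : (saddleMatrix e A).mulVec z = Sum.elim (0 : ι → ℝ) (A y) := by
    rw [hz, Matrix.mulVec_mulVec, Matrix.mul_nonsing_inv _
      (isUnit_iff_ne_zero.2 (det_saddleMatrix_ne_zero e hA)), Matrix.one_mulVec]
  have hv := inner_eq_of_saddleMatrix_mulVec_inl e A (z := z) fun i ↦ by rw [hMz]; rfl
  have hAh : A (∑ j, z (.inl j) • e j) = A y := by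
    ext a
    rw [← saddleMatrix_mulVec_inr, hMz]
    rfl
  refine Submodule.eq_starProjection_of_mem_orthogonal ?_ ?_
  · rw [Submodule.mem_orthogonal]
    intro u hu
    rw [hv, LinearMap.mem_ker.1 hu]
    simp
  · rw [Submodule.orthogonal_orthogonal, LinearMap.mem_ker, map_sub, hAh, sub_self]

end LinearAlgebra

/-! ### Smoothness of determinants and inverse matrices. -/

section SmoothMatrix

variable {E : Type*} [NormedAddCommGroup E] [NormedSpace ℝ E]
  {M : Type*} [TopologicalSpace M] [ChartedSpace E M] {n : WithTop ℕ∞}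
  {ι : Type*} [Fintype ι] [DecidableEq ι]

lemma contMDiffAt_det {B : M → Matrix ι ι ℝ} {x : M}
    (hB : ∀ i j, CMDiffAt n (fun q ↦ B q i j) x) : CMDiffAt n (fun q ↦ (B q).det) x := by
  simp only [Matrix.det_apply']
  exact contMDiffAt_finsetSum fun σ _ ↦
    contMDiffAt_const.mul (contMDiffAt_finsetProd fun i _ ↦ hB _ _)

lemma contMDiffAt_matrix_inv {B : M → Matrix ι ι ℝ} {x : M}
    (hB : ∀ i j, CMDiffAt n (fun q ↦ B q i j) x) (hx : (B x).det ≠ 0) (i j : ι) :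
    CMDiffAt n (fun q ↦ (B q)⁻¹ i j) x := by
  simp only [Matrix.inv_def, Matrix.smul_apply, Ring.inverse_eq_inv', smul_eq_mul,
    Matrix.adjugate_apply]
  refine ((contMDiffAt_det hB).inv₀ hx).mul (contMDiffAt_det fun k l ↦ ?_)
  -- By Cramer's rule the adjugate entry is a determinant in which row `j` is replaced by a constant
  -- unit vector.
  by_cases h : k = j
  · subst h
    simpa using contMDiffAt_const
  · simpa [Matrix.updateRow_ne h] using hB k l

end SmoothMatrix

/-! ### Smoothness of the horizontal projection. -/

section SmoothProjection

attribute [local instance] finiteDimensional_tangent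

variable {E : Type*} [NormedAddCommGroup E] [NormedSpace ℝ E]
  {M : Type*} [TopologicalSpace M] [ChartedSpace E M]
  {E' : Type*} [NormedAddCommGroup E'] [NormedSpace ℝ E'] [FiniteDimensional ℝ E']
  {N : Type*} [TopologicalSpace N] [ChartedSpace E' N] [IsManifold 𝓘(ℝ, E') ∞ N]

/-- The differential of `F` at `q`, read in the trivialization of `TN` around `y`. -/
def mfderivCoord (F : M → N) (y : N) (q : M) :
    TangentSpace 𝓘(ℝ, E) q →ₗ[ℝ] Fin (Module.finrank ℝ E') → ℝ :=
  (Module.finBasis ℝ E').equivFun.toLinearMap ∘ₗ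
    ((trivializationAt E' (fun y : N ↦ TangentSpace 𝓘(ℝ, E') y) y).linearMapAt ℝ (F q)) ∘ₗ
    (mfderiv 𝓘(ℝ, E) 𝓘(ℝ, E') F q).toLinearMap

lemma surjective_mfderivCoord {F : M → N} {y : N} {q : M}
    (hq : F q ∈ (trivializationAt E' (fun y : N ↦ TangentSpace 𝓘(ℝ, E') y) y).baseSet)
    (hF : Function.Surjective (mfderiv 𝓘(ℝ, E) 𝓘(ℝ, E') F q)) :
    Function.Surjective (mfderivCoord (E := E) (E' := E') F y q) := by
  have := ((Trivialization.linearEquivAt (R := ℝ)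
    (trivializationAt E' (fun y : N ↦ TangentSpace 𝓘(ℝ, E') y) y) (F q) hq).surjective).comp hF
  have := (Module.finBasis ℝ E').equivFun.surjective.comp this
  convert this using 1
  ext v
  simp only [mfderivCoord, LinearMap.comp_apply, Trivialization.linearMapAt_apply, if_pos hq]
  rfl

lemma ker_mfderivCoord {F : M → N} {y : N} {q : M}
    (hq : F q ∈ (trivializationAt E' (fun y : N ↦ TangentSpace 𝓘(ℝ, E') y) y).baseSet) :
    (mfderivCoord (E := E) (E' := E') F y q).ker = vertical (E := E) (E' := E') F q := by
  ext v
  simp only [mfderivCoord, vertical, LinearMap.mem_ker, LinearMap.comp_apply,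
    LinearEquiv.coe_coe, LinearEquiv.map_eq_zero_iff]
  rw [Trivialization.linearMapAt_def_of_mem _ hq]
  exact LinearEquiv.map_eq_zero_iff _

variable [IsManifold 𝓘(ℝ, E) ∞ M]

lemma contMDiffAt_mfderivCoord {F : M → N} (hF : ContMDiff 𝓘(ℝ, E) 𝓘(ℝ, E') ∞ F)
    {x : M} {Y : Π x : M, TangentSpace 𝓘(ℝ, E) x} (hY : CMDiffAt ∞ (T% Y) x)
    (a : Fin (Module.finrank ℝ E')) :
    CMDiffAt ∞ (fun q ↦ mfderivCoord (E' := E') F (F x) q (Y q) a) x := by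
  have h1 : ContMDiffAt 𝓘(ℝ, E) (𝓘(ℝ, E').prod 𝓘(ℝ, E')) ∞
      (fun q ↦ tangentMap 𝓘(ℝ, E) 𝓘(ℝ, E') F (⟨q, Y q⟩ : TangentBundle 𝓘(ℝ, E) M)) x :=
    ((hF.contMDiff_tangentMap (m := ∞) (by simp)) _).comp x hY
  have h2 := (contMDiffAt_totalSpace.1 h1).2
  have h3 := ((Module.finBasis ℝ E').equivFunL.toContinuousLinearMap.contDiff
    (n := ∞)).contMDiff.contMDiffAt.comp x h2
  have h4 := contMDiffAt_pi_space.1 h3 a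
  refine h4.congr_of_eventuallyEq ?_
  -- `linearMapAt` is zero by convention off the base set, so the coordinates agree with those of
  -- the tangent map only near `x`.
  have hmem : ∀ᶠ q in 𝓝 x, F q ∈
      (trivializationAt E' (fun y : N ↦ TangentSpace 𝓘(ℝ, E') y) (F x)).baseSet :=
    hF.continuous.continuousAt.eventually
      ((trivializationAt E' (fun y : N ↦ TangentSpace 𝓘(ℝ, E') y) (F x)).open_baseSet.mem_nhds
        (FiberBundle.mem_baseSet_trivializationAt' _))
  filter_upwards [hmem] with q hq
  simp only [mfderivCoord, LinearMap.comp_apply, Trivialization.linearMapAt_apply, if_pos hq]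
  rfl

variable [FiniteDimensional ℝ E]

/-- Every tangent vector is the value of a smooth vector field on `M`. -/
lemma exists_contMDiff_extend [T2Space M] (x : M) (v : TangentSpace 𝓘(ℝ, E) x) :
    ∃ Z : Π x : M, TangentSpace 𝓘(ℝ, E) x, CMDiff ∞ (T% Z) ∧ Z x = v := by
  obtain ⟨s, hs, hsm⟩ := FiberBundle.exists_contMDiffOn_extend (k := ∞) 𝓘(ℝ, E) E v
  obtain ⟨u, hus, hu, hxu⟩ := mem_nhds_iff.1 hs
  -- A bump function equal to `1` at `x`, supported where the local extension is smooth, cuts that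
  -- extension off to a global field.
  obtain ⟨f, -, hf⟩ := (SmoothBumpFunction.nhds_basis_tsupport (I := 𝓘(ℝ, E)) x).mem_iff.1
    (hu.mem_nhds hxu)
  refine ⟨(f : M → ℝ) • FiberBundle.extend E v, ?_, by simp⟩
  exact ContMDiffOn.smul_section_of_tsupport f.contMDiff.contMDiffOn hu hf (hsm.mono hus)

variable [RiemannianBundle (fun x : M ↦ TangentSpace 𝓘(ℝ, E) x)]
  [IsContMDiffRiemannianBundle 𝓘(ℝ, E) ∞ E (fun x : M ↦ TangentSpace 𝓘(ℝ, E) x)]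

/-- The horizontal projection of a smooth vector field is smooth. -/
lemma contMDiffAt_horPart {F : M → N} (hF : ContMDiff 𝓘(ℝ, E) 𝓘(ℝ, E') ∞ F)
    (hsub : ∀ x, Function.Surjective (mfderiv 𝓘(ℝ, E) 𝓘(ℝ, E') F x))
    {x : M} {Y : Π x : M, TangentSpace 𝓘(ℝ, E) x} (hY : CMDiffAt ∞ (T% Y) x) :
    CMDiffAt ∞ (T% (fun q ↦ horPart (E' := E') F q (Y q))) x := by
  set t := trivializationAt E (fun x : M ↦ TangentSpace 𝓘(ℝ, E) x) x
  set b := Module.finBasis ℝ E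
  have hx : x ∈ t.baseSet := FiberBundle.mem_baseSet_trivializationAt' x
  have hFx : F x ∈ (trivializationAt E' (fun y : N ↦ TangentSpace 𝓘(ℝ, E') y) (F x)).baseSet :=
    FiberBundle.mem_baseSet_trivializationAt' _
  have he (i) : CMDiffAt ∞ (T% (t.localFrame b i)) x := contMDiffAt_localFrame_of_mem ∞ t b i hx
  have heq {q : M} (hq : q ∈ t.baseSet) : (fun i ↦ t.localFrame b i q) = t.basisAt b hq := by
    ext i
    rw [t.localFrame_apply_of_mem_baseSet b hq]
  -- In a local frame the Gram matrix and the coordinates of `F_*` have smooth entries, and `B x` is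
  -- invertible because `F` is a submersion at `x`.
  set B := fun q : M ↦ saddleMatrix (fun i ↦ t.localFrame b i q)
    (mfderivCoord (E := E) (E' := E') F (F x) q) with hB
  have hBs (r s) : CMDiffAt ∞ (fun q ↦ B q r s) x := by
    rcases r with i | a <;> rcases s with j | c
    · exact ContMDiffAt.inner_bundle (E := fun x : M ↦ TangentSpace 𝓘(ℝ, E) x)
        (IB := 𝓘(ℝ, E)) (F := E) (b := id) (he i) (he j)
    · exact (contMDiffAt_mfderivCoord hF (he i) c).neg
    · exact contMDiffAt_mfderivCoord hF (he j) a
    · exact contMDiffAt_const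
  have hdet : (B x).det ≠ 0 := by
    simp only [hB, heq hx]
    exact det_saddleMatrix_ne_zero _ (surjective_mfderivCoord hFx (hsub x))
  have hcoef (i) : CMDiffAt ∞ (fun q ↦ (B q)⁻¹.mulVec
      (Sum.elim 0 (mfderivCoord (E' := E') F (F x) q (Y q))) (.inl i)) x := by
    simp only [Matrix.mulVec, dotProduct]
    refine contMDiffAt_finsetSum fun s _ ↦ (contMDiffAt_matrix_inv hBs hdet _ s).mul ?_
    rcases s with j | a
    · exact contMDiffAt_const
    · exact contMDiffAt_mfderivCoord hF hY a
  have hsum := ContMDiffAt.sum_section (s := Finset.univ) fun i _ ↦ (hcoef i).smul_section (he i)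
  refine hsum.congr_of_eventuallyEq ?_
  -- The projection formula holds where `q` and `F q` both lie in the base sets of their
  -- trivializations.
  filter_upwards [t.open_baseSet.mem_nhds hx, hF.continuous.continuousAt.eventually
    ((trivializationAt E' (fun y : N ↦ TangentSpace 𝓘(ℝ, E') y) (F x)).open_baseSet.mem_nhds hFx)]
    with q hq hFq
  have := starProjection_ker_orthogonal_eq_sum (t.basisAt b hq)
    (surjective_mfderivCoord hFq (hsub q)) (Y q)
  rw [ker_mfderivCoord hFq] at this
  simp only [horPart, horizontal, this, hB, Pi.smul_apply',
    t.localFrame_apply_of_mem_baseSet b hq]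

end SmoothProjection

/-! ### Pointwise algebra of vertical and horizontal parts. -/

section Projections

attribute [local instance] finiteDimensional_tangent

variable {E : Type*} [NormedAddCommGroup E] [NormedSpace ℝ E]
  {M : Type*} [TopologicalSpace M] [ChartedSpace E M]
  {E' : Type*} [NormedAddCommGroup E'] [NormedSpace ℝ E']
  {N : Type*} [TopologicalSpace N] [ChartedSpace E' N]

lemma mvfderiv_eq_zero_of_eventuallyEq {f : M → ℝ} {x : M} (hf : f =ᶠ[𝓝 x] fun _ ↦ 0) :
    mvfderiv 𝓘(ℝ, E) f x = 0 := by
  have h1 : (mfderiv 𝓘(ℝ, E) 𝓘(ℝ, ℝ) f x : E →L[ℝ] ℝ) = 0 :=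
    hf.mfderiv_eq.trans mfderiv_const
  ext v
  exact congr($h1 v)

section

variable [IsManifold 𝓘(ℝ, E) ∞ M]

lemma IsSmoothFieldOn.mdiffAt {O : Set M} (hO : IsOpen O)
    {X : Π x : M, TangentSpace 𝓘(ℝ, E) x} (hX : IsSmoothFieldOn O X) {x : M} (hx : x ∈ O) :
    MDiffAt (T% X) x :=
  (hX.contMDiffAt (hO.mem_nhds hx)).mdifferentiableAt (by simp)

end

variable {F : M → N} {x : M}

lemma mfderiv_of_mem_vertical {v : TangentSpace 𝓘(ℝ, E) x}
    (hv : v ∈ vertical (E' := E') F x) : mfderiv 𝓘(ℝ, E) 𝓘(ℝ, E') F x v = 0 :=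
  hv

variable [RiemannianBundle (fun x : M ↦ TangentSpace 𝓘(ℝ, E) x)]

lemma inner_eq_zero_of_vertical_of_horizontal {v w : TangentSpace 𝓘(ℝ, E) x}
    (hv : v ∈ vertical (E' := E') F x) (hw : w ∈ horizontal (E' := E') F x) :
    (inner ℝ v w : ℝ) = 0 :=
  Submodule.inner_right_of_mem_orthogonal hv hw

variable [FiniteDimensional ℝ E] (F x)

lemma verPart_add_horPart (v : TangentSpace 𝓘(ℝ, E) x) :
    verPart (E' := E') F x v + horPart (E' := E') F x v = v :=
  Submodule.starProjection_add_starProjection_orthogonal v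

lemma verPart_mem (v : TangentSpace 𝓘(ℝ, E) x) :
    verPart (E' := E') F x v ∈ vertical (E' := E') F x :=
  Submodule.starProjection_apply_mem _ v

lemma horPart_mem (v : TangentSpace 𝓘(ℝ, E) x) :
    horPart (E' := E') F x v ∈ horizontal (E' := E') F x :=
  Submodule.starProjection_apply_mem _ v

variable {F x}

lemma verPart_of_mem_vertical {v : TangentSpace 𝓘(ℝ, E) x} (hv : v ∈ vertical (E' := E') F x) :
    verPart (E' := E') F x v = v :=
  Submodule.starProjection_eq_self_iff.2 hv

lemma horPart_of_mem_horizontal {v : TangentSpace 𝓘(ℝ, E) x}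
    (hv : v ∈ horizontal (E' := E') F x) : horPart (E' := E') F x v = v :=
  Submodule.starProjection_eq_self_iff.2 hv

lemma verPart_of_mem_horizontal {v : TangentSpace 𝓘(ℝ, E) x}
    (hv : v ∈ horizontal (E' := E') F x) : verPart (E' := E') F x v = 0 := by
  have := verPart_add_horPart (E' := E') F x v
  rwa [horPart_of_mem_horizontal hv, add_eq_right] at this

lemma horPart_of_mem_vertical {v : TangentSpace 𝓘(ℝ, E) x} (hv : v ∈ vertical (E' := E') F x) :
    horPart (E' := E') F x v = 0 := by
  have := verPart_add_horPart (E' := E') F x v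
  rwa [verPart_of_mem_vertical hv, add_eq_left] at this

lemma inner_verPart_of_mem_vertical {v : TangentSpace 𝓘(ℝ, E) x}
    (hv : v ∈ vertical (E' := E') F x) (w : TangentSpace 𝓘(ℝ, E) x) :
    (inner ℝ v (verPart (E' := E') F x w) : ℝ) = inner ℝ v w := by
  conv_rhs => rw [← verPart_add_horPart (E' := E') F x w, inner_add_right,
    inner_eq_zero_of_vertical_of_horizontal hv (horPart_mem F x w), add_zero]

lemma inner_horPart_of_mem_horizontal {v : TangentSpace 𝓘(ℝ, E) x}
    (hv : v ∈ horizontal (E' := E') F x) (w : TangentSpace 𝓘(ℝ, E) x) :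
    (inner ℝ (horPart (E' := E') F x w) v : ℝ) = inner ℝ w v := by
  conv_rhs => rw [← verPart_add_horPart (E' := E') F x w, inner_add_left,
    inner_eq_zero_of_vertical_of_horizontal (verPart_mem F x w) hv, zero_add]

lemma mfderiv_horPart (v : TangentSpace 𝓘(ℝ, E) x) :
    mfderiv 𝓘(ℝ, E) 𝓘(ℝ, E') F x (horPart (E' := E') F x v) =
      mfderiv 𝓘(ℝ, E) 𝓘(ℝ, E') F x v := by
  conv_rhs => rw [← verPart_add_horPart (E' := E') F x v, map_add,
    mfderiv_of_mem_vertical (verPart_mem F x v), zero_add]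

end Projections

/-! ### The second fundamental form on `D₁` and the equivalence. -/

section SemiInvariant

set_option linter.unusedSectionVars false

attribute [local instance] finiteDimensional_tangent

variable {E : Type*} [NormedAddCommGroup E] [NormedSpace ℝ E] [FiniteDimensional ℝ E]
  {M : Type*} [TopologicalSpace M] [ChartedSpace E M] [IsManifold 𝓘(ℝ, E) ∞ M]
  [RiemannianBundle (fun x : M ↦ TangentSpace 𝓘(ℝ, E) x)]
  [IsContMDiffRiemannianBundle 𝓘(ℝ, E) ∞ E (fun x : M ↦ TangentSpace 𝓘(ℝ, E) x)]
  {E' : Type*} [NormedAddCommGroup E'] [NormedSpace ℝ E'] [FiniteDimensional ℝ E']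
  {N : Type*} [TopologicalSpace N] [ChartedSpace E' N] [IsManifold 𝓘(ℝ, E') ∞ N]
  [RiemannianBundle (fun y : N ↦ TangentSpace 𝓘(ℝ, E') y)]
  [IsContMDiffRiemannianBundle 𝓘(ℝ, E') ∞ E' (fun y : N ↦ TangentSpace 𝓘(ℝ, E') y)]

/-- The second fundamental form of `F` on a locally vertical second argument. -/
lemma secondFundamentalForm_of_eventually_vertical {F : M → N}
    (X : Π x : M, TangentSpace 𝓘(ℝ, E) x) {Y : Π x : M, TangentSpace 𝓘(ℝ, E) x} {x : M}
    (hY : ∀ᶠ q in 𝓝 x, Y q ∈ vertical (E' := E') F q) :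
    secondFundamentalForm (E' := E') F X Y x =
      -mfderiv 𝓘(ℝ, E) 𝓘(ℝ, E') F x (leviCivita Y x (X x)) := by
  rw [secondFundamentalForm, sub_eq_neg_self]
  unfold covAlong
  refine Finset.sum_eq_zero fun i _ ↦ ?_
  -- The frame coefficients of `F_* Y` vanish on a neighbourhood, so their derivatives vanish at `x`
  -- as well as their values.
  have h0 : (fun q ↦ (trivializationAt E' (fun y : N ↦ TangentSpace 𝓘(ℝ, E') y)
      (F x)).localFrameCoeff 𝓘(ℝ, E') (Module.finBasis ℝ E') i (F q)
        (mfderiv 𝓘(ℝ, E) 𝓘(ℝ, E') F q (Y q))) =ᶠ[𝓝 x] fun _ ↦ (0 : ℝ) := by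
    filter_upwards [hY] with q hq
    rw [mfderiv_of_mem_vertical hq, map_zero]
  have h1 := mvfderiv_eq_zero_of_eventuallyEq (E := E) h0
  have h2 := h0.self_of_nhds
  dsimp only at h2
  rw [h1, h2, zero_apply, zero_smul, zero_smul, add_zero]

/-- O'Neill's tensor applied to a horizontal field. -/
lemma inner_oneillT_of_horizontal {F : M → N} {U V W : Π x : M, TangentSpace 𝓘(ℝ, E) x} {x : M}
    (hU : MDiffAt (T% U) x) (hV : MDiffAt (T% V) x) (hW : MDiffAt (T% W) x)
    (hUv : ∀ᶠ q in 𝓝 x, U q ∈ vertical (E' := E') F q) (hVv : V x ∈ vertical (E' := E') F x)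
    (hWh : ∀ q, W q ∈ horizontal (E' := E') F q) :
    (inner ℝ (U x) (oneillT (E' := E') F V W x) : ℝ) =
      -inner ℝ (leviCivita U x (V x)) (W x) := by
  have h1 : (fun q ↦ verPart (E' := E') F q (W q)) = 0 :=
    funext fun q ↦ verPart_of_mem_horizontal (hWh q)
  have h2 : (fun q ↦ horPart (E' := E') F q (W q)) = W :=
    funext fun q ↦ horPart_of_mem_horizontal (hWh q)
  -- Differentiating `g(U, W) = 0` along `V` exchanges `g(U, ∇_V W)` for `-g(∇_V U, W)`.
  have h3 : dInner U W x = 0 := by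
    have : (fun q ↦ (inner ℝ (U q) (W q) : ℝ)) =ᶠ[𝓝 x] fun _ ↦ 0 := by
      filter_upwards [hUv] with q hq
      exact inner_eq_zero_of_vertical_of_horizontal hq (hWh q)
    exact mvfderiv_eq_zero_of_eventuallyEq (E := E) this
  have h4 := leviCivita_metric hV hU hW
  rw [h3, zero_apply] at h4
  rw [oneillT, h1, h2, CovariantDerivative.zero, verPart_of_mem_vertical hVv]
  simp only [Pi.zero_apply, zero_apply, map_zero, zero_add]
  rw [inner_verPart_of_mem_vertical hUv.self_of_nhds]
  linarith

/-- An isometry whose square is `-1` is skew-adjoint. -/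
lemma IsQuaternionicHermitianBasis.inner_left
    {Q : Π x : M, Submodule ℝ (TangentSpace 𝓘(ℝ, E) x →L[ℝ] TangentSpace 𝓘(ℝ, E) x)}
    {O : Set M} {J : Fin 3 → Π x : M, TangentSpace 𝓘(ℝ, E) x →L[ℝ] TangentSpace 𝓘(ℝ, E) x}
    (hJ : IsQuaternionicHermitianBasis Q O J) (α : Fin 3) {x : M} (hx : x ∈ O)
    (v w : TangentSpace 𝓘(ℝ, E) x) :
    (inner ℝ (J α x v) w : ℝ) = -inner ℝ v (J α x w) := by
  rw [← hJ.hermitian α x hx v, hJ.sq α x hx, inner_neg_right, neg_neg]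

variable {Q : Π x : M, Submodule ℝ (TangentSpace 𝓘(ℝ, E) x →L[ℝ] TangentSpace 𝓘(ℝ, E) x)}
  {F : M → N} {lam : M → ℝ} {O : Set M}
  {J : Fin 3 → Π x : M, TangentSpace 𝓘(ℝ, E) x →L[ℝ] TangentSpace 𝓘(ℝ, E) x}
  {D₁ : Π x : M, Submodule ℝ (TangentSpace 𝓘(ℝ, E) x)}
  {θ : Fin 3 → Π x : M, TangentSpace 𝓘(ℝ, E) x →L[ℝ] ℝ}

namespace IsSemiInvariantBasis

lemma apply_mem (hJ : IsSemiInvariantBasis (E' := E') Q F O J D₁) (α : Fin 3) {x : M}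
    (hx : x ∈ O) {v : TangentSpace 𝓘(ℝ, E) x} (hv : v ∈ D₁ x) : J α x v ∈ D₁ x :=
  hJ.map_one α x hx ▸ Submodule.mem_map_of_mem hv

lemma apply_mem_horizontal (hJ : IsSemiInvariantBasis (E' := E') Q F O J D₁) (α : Fin 3) {x : M}
    (hx : x ∈ O) {v : TangentSpace 𝓘(ℝ, E) x} (hv : v ∈ distTwo (E' := E') F D₁ x) :
    J α x v ∈ horizontal (E' := E') F x :=
  hJ.map_two α x hx (Submodule.mem_map_of_mem hv)

/-- This is the orthogonal splitting `D₁ ⊕ D₂ ⊕ horizontal`. In finite dimension `D₁` is its own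
double complement, so being orthogonal to the other two summands suffices. -/
lemma mem_iff (hJ : IsSemiInvariantBasis (E' := E') Q F O J D₁) {x : M} (hx : x ∈ O)
    {v : TangentSpace 𝓘(ℝ, E) x} :
    v ∈ D₁ x ↔ (∀ z ∈ distTwo (E' := E') F D₁ x, (inner ℝ v z : ℝ) = 0) ∧
      ∀ z ∈ horizontal (E' := E') F x, (inner ℝ v z : ℝ) = 0 := by
  refine ⟨fun hv ↦ ⟨fun z hz ↦ Submodule.inner_right_of_mem_orthogonal hv hz.1,
    fun z hz ↦ inner_eq_zero_of_vertical_of_horizontal (hJ.le_vertical x hx hv) hz⟩,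
    fun ⟨h2, hh⟩ ↦ ?_⟩
  have hvv : v ∈ vertical (E' := E') F x := by
    have h : v ∈ (horizontal (E' := E') F x)ᗮ := (Submodule.mem_orthogonal' _ _).2 hh
    rwa [horizontal, Submodule.orthogonal_orthogonal] at h
  rw [← Submodule.orthogonal_orthogonal (D₁ x), Submodule.mem_orthogonal']
  intro u hu
  rw [← verPart_add_horPart (E' := E') F x u, inner_add_right, hh _ (horPart_mem F x u), add_zero]
  refine h2 _ ⟨(Submodule.mem_orthogonal _ _).2 fun d hd ↦ ?_, verPart_mem F x u⟩
  rw [inner_verPart_of_mem_vertical (hJ.le_vertical x hx hd)]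
  exact Submodule.inner_right_of_mem_orthogonal hd hu

/-- `B_R X` takes values in `D₂`. -/
lemma verPart_apply_mem_distTwo (hJ : IsSemiInvariantBasis (E' := E') Q F O J D₁) (α : Fin 3)
    {x : M} (hx : x ∈ O) {v : TangentSpace 𝓘(ℝ, E) x} (hv : v ∈ horizontal (E' := E') F x) :
    verPart (E' := E') F x (J α x v) ∈ distTwo (E' := E') F D₁ x := by
  refine ⟨(Submodule.mem_orthogonal _ _).2 fun d hd ↦ ?_, verPart_mem F x _⟩
  rw [inner_verPart_of_mem_vertical (hJ.le_vertical x hx hd), ← neg_eq_zero,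
    ← hJ.basis.inner_left α hx]
  exact inner_eq_zero_of_vertical_of_horizontal
    (hJ.le_vertical x hx (hJ.apply_mem α hx hd)) hv

/-- `ω_R B_R X = -X - R C_R X`. -/
lemma omegaPart_bPart (hJ : IsSemiInvariantBasis (E' := E') Q F O J D₁) (α : Fin 3)
    {x : M} (hx : x ∈ O) {X : Π x : M, TangentSpace 𝓘(ℝ, E) x}
    (hX : X x ∈ horizontal (E' := E') F x) :
    omegaPart (E' := E') F (J α) (bPart (E' := E') F (J α) X) x =
      -X x - J α x (cPart (E' := E') F (J α) X x) := by
  -- As `B X ∈ D₂`, the vector `R B X` is already horizontal and the projection does nothing; then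
  -- `R B X + R C X = R² X = -X`.
  rw [omegaPart, bPart, horPart_of_mem_horizontal
    (hJ.apply_mem_horizontal α hx (hJ.verPart_apply_mem_distTwo α hx hX)), cPart,
    eq_sub_iff_add_eq, ← map_add, verPart_add_horPart, hJ.basis.sq α x hx]

lemma isSmoothFieldOn_apply (hJ : IsSemiInvariantBasis (E' := E') Q F O J D₁) (α : Fin 3)
    {X : Π x : M, TangentSpace 𝓘(ℝ, E) x} (hX : IsSmoothFieldOn O X) :
    IsSmoothFieldOn O (fun q ↦ J α q (X q)) :=
  ContMDiffOn.clm_bundle_apply (hJ.basis.smooth α) hX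

/-- The pullback derivative disappears because `R U` is vertical throughout `O`. Of `∇_V (R U)`, the
part coming from `∇R` is a combination of vectors `J β U ∈ D₁`, hence vertical. -/
lemma secondFundamentalForm_eq (hO : IsOpen O)
    (hJ : IsSemiInvariantBasis (E' := E') Q F O J D₁) (hθ : IsConnectionForms O J θ) (α : Fin 3)
    {U V : Π x : M, TangentSpace 𝓘(ℝ, E) x} (hU : IsSectionOn O D₁ U) (hV : IsSectionOn O D₁ V)
    {x : M} (hx : x ∈ O) :
    secondFundamentalForm (E' := E') F V (fun q ↦ J α q (U q)) x =
      -mfderiv 𝓘(ℝ, E) 𝓘(ℝ, E') F x (J α x (leviCivita U x (V x))) := by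
  rw [secondFundamentalForm_of_eventually_vertical, neg_inj,
    sub_eq_iff_eq_add.1 (hθ.deriv α V U hV.1 hU.1 x hx), map_add, add_eq_right]
  · refine mfderiv_of_mem_vertical (hJ.le_vertical x hx ?_)
    exact sub_mem (Submodule.smul_mem _ _ (hJ.apply_mem _ hx (hU.2 x hx)))
      (Submodule.smul_mem _ _ (hJ.apply_mem _ hx (hU.2 x hx)))
  · filter_upwards [hO.mem_nhds hx] with q hq
    exact hJ.le_vertical q hq (hJ.apply_mem α hq (hU.2 q hq))

/-- `F_*` sees only the horizontal part of `R w`, and this lies in `μ^R` exactly when it is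
orthogonal to `R D₂`. Since `R` is an isometry, that is orthogonality of `w` to `D₂`. -/
lemma neg_mfderiv_mem_map_distMu_iff (hJ : IsSemiInvariantBasis (E' := E') Q F O J D₁)
    (α : Fin 3) {x : M} (hx : x ∈ O) (w : TangentSpace 𝓘(ℝ, E) x) :
    -mfderiv 𝓘(ℝ, E) 𝓘(ℝ, E') F x (J α x w) ∈
        (distMu (E' := E') F D₁ (J α) x).map (mfderiv 𝓘(ℝ, E) 𝓘(ℝ, E') F x).toLinearMap ↔
      ∀ z ∈ distTwo (E' := E') F D₁ x, (inner ℝ w z : ℝ) = 0 := by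
  constructor
  · rintro ⟨m, hm, hmw⟩ z hz
    -- A preimage `m ∈ μ^R` need only agree with `-R w` modulo vertical vectors, which are
    -- orthogonal to `R D₂`.
    have h1 : m + J α x w ∈ vertical (E' := E') F x := by
      change mfderiv 𝓘(ℝ, E) 𝓘(ℝ, E') F x (m + J α x w) = 0
      rw [map_add]
      exact eq_neg_iff_add_eq_zero.1 hmw
    have h2 := inner_eq_zero_of_vertical_of_horizontal h1 (hJ.apply_mem_horizontal α hx hz)
    have h3 : (inner ℝ m (J α x z) : ℝ) = 0 :=
      Submodule.inner_left_of_mem_orthogonal (Submodule.mem_map_of_mem hz) hm.1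
    rwa [inner_add_left, h3, zero_add, hJ.basis.hermitian α x hx] at h2
  · intro h
    refine ⟨-horPart (E' := E') F x (J α x w), ⟨neg_mem ?_, neg_mem (horPart_mem F x _)⟩, ?_⟩
    · refine (Submodule.mem_orthogonal' _ _).2 ?_
      rintro _ ⟨z, hz, rfl⟩
      exact (inner_horPart_of_mem_horizontal (hJ.apply_mem_horizontal α hx hz) _).trans
        ((hJ.basis.hermitian α x hx w z).trans (h z hz))
    · rw [map_neg]
      exact congrArg _ (mfderiv_horPart _)

lemma isSmoothFieldOn_omegaPart_bPart (hO : IsOpen O)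
    (hF : IsHConformalSubmersion (E := E) (E' := E') F lam)
    (hJ : IsSemiInvariantBasis (E' := E') Q F O J D₁) (α : Fin 3)
    {X : Π x : M, TangentSpace 𝓘(ℝ, E) x} (hX : IsSmoothFieldOn O X) :
    IsSmoothFieldOn O (omegaPart (E' := E') F (J α) (bPart (E' := E') F (J α) X)) := by
  have hh {Y : Π x : M, TangentSpace 𝓘(ℝ, E) x} (hY : IsSmoothFieldOn O Y) :
      IsSmoothFieldOn O (fun q ↦ horPart (E' := E') F q (Y q)) := fun x hx ↦
    (contMDiffAt_horPart hF.smooth hF.submersion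
      (hY.contMDiffAt (hO.mem_nhds hx))).contMDiffWithinAt
  refine hh (hJ.isSmoothFieldOn_apply α ?_)
  have hRX := hJ.isSmoothFieldOn_apply α hX
  -- The vertical part is the field minus its horizontal part, so it is smooth too.
  refine (hRX.sub_section (hh hRX)).congr fun q _ ↦ ?_
  congr 1
  exact eq_sub_iff_add_eq.2 (verPart_add_horPart F q _)

/-- The equation of `SecondFundamentalFormCondition` at a point says that `∇_V U` is orthogonal
to `X`. -/
lemma inner_secondFundamentalForm_eq_iff (hO : IsOpen O)
    (hF : IsHConformalSubmersion (E := E) (E' := E') F lam)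
    (hJ : IsSemiInvariantBasis (E' := E') Q F O J D₁) (hθ : IsConnectionForms O J θ) (α : Fin 3)
    {U V X : Π x : M, TangentSpace 𝓘(ℝ, E) x} (hU : IsSectionOn O D₁ U) (hV : IsSectionOn O D₁ V)
    (hX : IsSectionOn O (horizontal (E' := E') F) X) {x : M} (hx : x ∈ O) :
    ((inner ℝ (secondFundamentalForm F V (fun q ↦ J α q (U q)) x)
          (mfderiv 𝓘(ℝ, E) 𝓘(ℝ, E') F x (cPart (E' := E') F (J α) X x)) : ℝ) =
        lam x ^ 2 * inner ℝ (U x) (oneillT (E' := E') F V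
            (omegaPart (E' := E') F (J α) (bPart (E' := E') F (J α) X)) x)
        - lam x ^ 2 *
          (inner ℝ (θ 2 x (V x) • phiPart (E' := E') F (J (α + 1)) U x) (J α x (X x))
            - inner ℝ (θ 2 x (V x) • omegaPart (E' := E') F (J (α + 1)) U x) (J α x (X x)))
        + lam x ^ 2 *
          (inner ℝ (θ 1 x (V x) • phiPart (E' := E') F (J (α + 2)) U x) (J α x (X x))
            + inner ℝ (θ 1 x (V x) • omegaPart (E' := E') F (J (α + 2)) U x) (J α x (X x)))) ↔
      (inner ℝ (leviCivita U x (V x)) (X x) : ℝ) = 0 := by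
  have hvert (β : Fin 3) : J β x (U x) ∈ vertical (E' := E') F x :=
    hJ.le_vertical x hx (hJ.apply_mem β hx (hU.2 x hx))
  have homega (β : Fin 3) : omegaPart (E' := E') F (J β) U x = 0 :=
    horPart_of_mem_vertical (hvert β)
  have hphi (β : Fin 3) :
      (inner ℝ (phiPart (E' := E') F (J β) U x) (J α x (X x)) : ℝ) = 0 := by
    -- Skew-adjointness moves `J α` onto `J β U`, which stays in `D₁` and so is orthogonal to the
    -- horizontal `X`.
    rw [phiPart, verPart_of_mem_vertical (hvert β), ← neg_eq_zero, ← hJ.basis.inner_left α hx]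
    exact inner_eq_zero_of_vertical_of_horizontal
      (hJ.le_vertical x hx (hJ.apply_mem α hx (hJ.apply_mem β hx (hU.2 x hx)))) (hX.2 x hx)
  have hT := inner_oneillT_of_horizontal (E' := E') (F := F) (hU.1.mdiffAt hO hx)
    (hV.1.mdiffAt hO hx)
    ((hJ.isSmoothFieldOn_omegaPart_bPart hO hF α hX.1).mdiffAt hO hx)
    (by filter_upwards [hO.mem_nhds hx] with q hq using hJ.le_vertical q hq (hU.2 q hq))
    (hJ.le_vertical x hx (hV.2 x hx)) (fun q ↦ horPart_mem F q _)
  have hC : cPart (E' := E') F (J α) X x ∈ horizontal (E' := E') F x := horPart_mem F x _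
  -- Conformality applies to horizontal vectors only, so `R w` is first replaced by its horizontal
  -- part. The terms in `g(w, R C X)` then cancel between the two sides.
  rw [hT, hJ.omegaPart_bPart α hx (hX.2 x hx), hJ.secondFundamentalForm_eq hO hθ α hU hV hx,
    ← mfderiv_horPart, inner_neg_left, hF.conformal x _ (horPart_mem F x _) _ hC,
    inner_horPart_of_mem_horizontal hC, hJ.basis.inner_left α hx]
  simp only [homega, real_inner_smul_left, hphi, smul_zero, inner_zero_left, inner_sub_right,
    inner_neg_right]
  have hlam := pow_ne_zero 2 (hF.dilation_pos x).ne'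
  constructor
  · intro h
    exact (mul_eq_zero.1 (by linarith : lam x ^ 2 * inner ℝ (leviCivita U x (V x)) (X x) = 0)
      ).resolve_left hlam
  · intro h
    rw [h]
    ring

/-- The leaves of `D₁` are totally geodesic if and only if the condition on the second
fundamental form of `F` attached to `J α` holds. -/
theorem definesTotallyGeodesicFoliation_iff [T2Space M] (hO : IsOpen O)
    (hF : IsHConformalSubmersion (E := E) (E' := E') F lam)
    (hJ : IsSemiInvariantBasis (E' := E') Q F O J D₁) (hθ : IsConnectionForms O J θ)
    (α : Fin 3) :
    DefinesTotallyGeodesicFoliation O D₁ ↔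
      SecondFundamentalFormCondition (E' := E') F lam O J D₁ θ α := by
  constructor
  · intro h U V hU hV
    have hw {x} (hx : x ∈ O) := (hJ.mem_iff hx).1 (h V U hV hU x hx).2
    refine ⟨fun x hx ↦ ?_, fun X hX x hx ↦ ?_⟩
    · rw [hJ.secondFundamentalForm_eq hO hθ α hU hV hx, hJ.neg_mfderiv_mem_map_distMu_iff α hx]
      exact (hw hx).1
    · rw [hJ.inner_secondFundamentalForm_eq_iff hO hF hθ α hU hV hX hx]
      exact (hw hx).2 _ (hX.2 x hx)
  · intro h
    have key {U V : Π x : M, TangentSpace 𝓘(ℝ, E) x} (hU : IsSectionOn O D₁ U)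
        (hV : IsSectionOn O D₁ V) {x : M} (hx : x ∈ O) : leviCivita U x (V x) ∈ D₁ x := by
      obtain ⟨h1, h2⟩ := h U V hU hV
      refine (hJ.mem_iff hx).2 ⟨?_, fun z hz ↦ ?_⟩
      · rw [← hJ.neg_mfderiv_mem_map_distMu_iff α hx,
          ← hJ.secondFundamentalForm_eq hO hθ α hU hV hx]
        exact h1 x hx
      -- The equation is assumed for horizontal fields only, so `z` is extended to a smooth field
      -- and projected; the projection fixes the value `z` at `x`.
      · obtain ⟨Z, hZ, rfl⟩ := exists_contMDiff_extend x z
        have hX : IsSectionOn O (horizontal (E' := E') F)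
            (fun q ↦ horPart (E' := E') F q (Z q)) :=
          ⟨fun q _ ↦ (contMDiffAt_horPart hF.smooth hF.submersion hZ.contMDiffAt).contMDiffWithinAt,
            fun q _ ↦ horPart_mem F q _⟩
        have := (hJ.inner_secondFundamentalForm_eq_iff hO hF hθ α hU hV hX hx).1 (h2 _ hX x hx)
        rwa [horPart_of_mem_horizontal hz] at this
    refine fun X Y hX hY x hx ↦ ⟨?_, key hY hX hx⟩
    -- Torsion-freeness writes the bracket as a difference of two covariant derivatives already
    -- known to lie in `D₁`.
    rw [← leviCivita_torsion (hX.1.mdiffAt hO hx) (hY.1.mdiffAt hO hx)]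
    exact sub_mem (key hY hX hx) (key hX hY hx)

end IsSemiInvariantBasis

end SemiInvariant

end HConformal
end

theorem mainTheorem6
    {E : Type*} [NormedAddCommGroup E] [NormedSpace ℝ E] [FiniteDimensional ℝ E]
    {M : Type*} [TopologicalSpace M] [T2Space M] [SecondCountableTopology M]
    [ChartedSpace E M] [IsManifold 𝓘(ℝ, E) ∞ M]
    [RiemannianBundle (fun x : M ↦ TangentSpace 𝓘(ℝ, E) x)]
    [IsContMDiffRiemannianBundle 𝓘(ℝ, E) ∞ E (fun x : M ↦ TangentSpace 𝓘(ℝ, E) x)]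
    {E' : Type*} [NormedAddCommGroup E'] [NormedSpace ℝ E'] [FiniteDimensional ℝ E']
    {N : Type*} [TopologicalSpace N] [T2Space N] [SecondCountableTopology N]
    [ChartedSpace E' N] [IsManifold 𝓘(ℝ, E') ∞ N]
    [RiemannianBundle (fun y : N ↦ TangentSpace 𝓘(ℝ, E') y)]
    [IsContMDiffRiemannianBundle 𝓘(ℝ, E') ∞ E' (fun y : N ↦ TangentSpace 𝓘(ℝ, E') y)]
    (Q : Π x : M, Submodule ℝ (TangentSpace 𝓘(ℝ, E) x →L[ℝ] TangentSpace 𝓘(ℝ, E) x))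
    (hQ : HConformal.IsQuaternionicKaehler Q)
    (F : M → N) (lam : M → ℝ)
    (hF : HConformal.IsHConformalSemiInvariantSubmersion (E' := E') Q F lam)
    (O : Set M) (hO : IsOpen O)
    (J : Fin 3 → Π x : M, TangentSpace 𝓘(ℝ, E) x →L[ℝ] TangentSpace 𝓘(ℝ, E) x)
    (D₁ : Π x : M, Submodule ℝ (TangentSpace 𝓘(ℝ, E) x))
    (hJ : HConformal.IsSemiInvariantBasis (E' := E') Q F O J D₁)
    (θ : Fin 3 → Π x : M, TangentSpace 𝓘(ℝ, E) x →L[ℝ] ℝ)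
    (hθ : HConformal.IsConnectionForms O J θ) :
    List.TFAE [HConformal.DefinesTotallyGeodesicFoliation O D₁,
      HConformal.SecondFundamentalFormCondition (E' := E') F lam O J D₁ θ 0,
      HConformal.SecondFundamentalFormCondition (E' := E') F lam O J D₁ θ 1,
      HConformal.SecondFundamentalFormCondition (E' := E') F lam O J D₁ θ 2] := by
  have h := HConformal.IsSemiInvariantBasis.definesTotallyGeodesicFoliation_iff hO hF.submersion
    hJ hθ
  tfae_have 1 ↔ 2 := h 0
  tfae_have 1 ↔ 3 := h 1
  tfae_have 1 ↔ 4 := h 2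
  tfae_finish
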